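/- Let $h:\mathbb{R}\to\mathbb{R}$ be $1$-periodic, of class $C^{1,1}$ (continuously differentiable with Lipschitz derivative), with $h>0$, and let $\Omega=\{(x,y): 0\le x\le 1,\ 0<y<h(x)\}$, periodic in $x$ (the points $(0,y)$ and $(1,y)$ are identified), with lower boundary $\Gamma_0=\{y=0\}$ and upper boundary $\Gamma_1=\{y=h(x)\}$. Let $H^2(\Omega)$ be the completion, in the usual Sobolev norm, of the $x$-periodic functions that are $C^2$ up to $\Gamma_0$ and $\Gamma_1$, and let $$\Psi=\left\{\psi\in H^2(\Omega)\ :\ \psi|_{\Gamma_0}=0,\ \ \psi_y|_{\Gamma_0}=0,\ \ \psi|_{\Gamma_1}=\text{const},\ \ \psi_y|_{\Gamma_1}=0\right\}$$ (boundary values in the trace sense). For $\varepsilon>0$ and $\psi,\phi\in H^2(\Omega)$ put $$a_\varepsilon(\psi,\phi)=\int_\Omega \psi_{yy}\phi_{yy}+2\varepsilon^2\psi_{xy}\phi_{xy}+\varepsilon^4\psi_{xx}\phi_{xx}\,dA,$$ $$\|\psi\|_{2,\varepsilon}^2=\int_\Omega\psi^2\,dA+\int_\Omega\left(\psi_y^2+(\varepsilon\psi_x)^2\right)dA+a_\varepsilon(\psi,\psi).$$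 Then the bilinear form $a_\varepsilon$ is coercive on $\Psi$, uniformly in $\varepsilon$: there is a constant $\alpha>0$, independent of $\varepsilon$ and $\psi$, such that $$\alpha\,\|\psi\|_{2,\varepsilon}^2\le a_\varepsilon(\psi,\psi)\qquad\text{for all }\varepsilon>0,\ \psi\in\Psi.$$ Moreover, if $h(x)\le 1$ for all $x$, this holds with $\alpha=\tfrac{12}{19}$, that is, $$\tfrac{12}{19}\,\|\psi\|_{2,\varepsilon}^2\le a_\varepsilon(\psi,\psi)\qquad\text{for all }\varepsilon>0,\ \psi\in\Psi.$$ -/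

import Mathlib

open MeasureTheory

noncomputable section

namespace Lubrication

/-- `C^{1,1}(T)`, `T` the periodic unit interval: continuously differentiable functions of period
one with Lipschitz continuous derivative. -/
def IsC11Periodic (h : ℝ → ℝ) : Prop :=
  (∀ x, h (x + 1) = h x) ∧ ContDiff ℝ 1 h ∧ ∃ K : NNReal, LipschitzWith K (deriv h)

/-- One period `{(x, y) : 0 ≤ x ≤ 1, 0 < y < h x}` of the fluid domain. -/
def Omega (h : ℝ → ℝ) : Set (ℝ × ℝ) :=
  {p | 0 ≤ p.1 ∧ p.1 ≤ 1 ∧ 0 < p.2 ∧ p.2 < h p.1}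

/-- The area measure `dA` on the domain. -/
abbrev area (h : ℝ → ℝ) : Measure (ℝ × ℝ) := volume.restrict (Omega h)

/-- Real `L²` of the domain. -/
abbrev L2Omega (h : ℝ → ℝ) := Lp ℝ 2 (area h)

/-- `L²` of either boundary curve, parametrized by `x ∈ [0, 1]`. -/
abbrev L2Boundary := Lp ℝ 2 ((volume : Measure ℝ).restrict (Set.Icc 0 1))

/-- `C²` functions up to the boundary of the periodic domain: restrictions of `C²` functions on the
plane that have period one in `x`. -/
def IsC2Periodic (φ : ℝ × ℝ → ℝ) : Prop :=
  ContDiff ℝ 2 φ ∧ ∀ x y, φ (x + 1, y) = φ (x, y)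

/-- Classical partial derivative `∂φ/∂x`. -/
def dx (φ : ℝ × ℝ → ℝ) (p : ℝ × ℝ) : ℝ := deriv (fun t => φ (t, p.2)) p.1

/-- Classical partial derivative `∂φ/∂y`. -/
def dy (φ : ℝ × ℝ → ℝ) (p : ℝ × ℝ) : ℝ := deriv (fun t => φ (p.1, t)) p.2

/-- Labels for the partial derivatives of order at most two (`o` is the function itself). -/
inductive D2 : Type
  | o | x | y | xx | xy | yy

/-- The classical partial derivative with the given label. -/
def partialD (φ : ℝ × ℝ → ℝ) : D2 → ℝ × ℝ → ℝ
  | .o => φ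
  | .x => dx φ
  | .y => dy φ
  | .xx => dx (dx φ)
  | .xy => dx (dy φ)
  | .yy => dy (dy φ)

/-- Families `(ψ, ψ_x, ψ_y, ψ_xx, ψ_xy, ψ_yy)` of square integrable functions. -/
abbrev Jet (h : ℝ → ℝ) := D2 → L2Omega h

/-- `J` is the family of classical derivatives of `φ`, restricted to the domain. -/
def IsJetOf (h : ℝ → ℝ) (J : Jet h) (φ : ℝ × ℝ → ℝ) : Prop :=
  ∀ i, (J i : ℝ × ℝ → ℝ) =ᵐ[area h] partialD φ i

/-- `H²` of the periodic domain, the completion of the periodic `C²` functions in the Sobolev norm,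
realized as the closure of `φ ↦ (φ, φ_x, φ_y, φ_xx, φ_xy, φ_yy)` in the sixfold product of `L²`.
The component `ψ .xy` of an element `ψ` is its weak derivative `ψ_xy`, and so on. -/
def H2 (h : ℝ → ℝ) : Set (Jet h) :=
  closure {J | ∃ φ, IsC2Periodic φ ∧ IsJetOf h J φ}

/-- `g` is the trace of `ψ` for the boundary operator `τ`, which is given on classical functions:
the pair `(ψ, g)` is a limit, in `H² × L²`, of pairs `(φ, τ φ)` with `φ` periodic and `C²`. -/
def HasTrace (h : ℝ → ℝ) (τ : (ℝ × ℝ → ℝ) → ℝ → ℝ) (ψ : H2 h) (g : L2Boundary) : Prop :=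
  ((ψ : Jet h), g) ∈ closure {q : Jet h × L2Boundary |
    ∃ φ, IsC2Periodic φ ∧ IsJetOf h q.1 φ ∧
      (q.2 : ℝ → ℝ) =ᵐ[volume.restrict (Set.Icc 0 1)] τ φ}

/-- Restriction to the lower boundary `y = 0`. -/
def onBottom (φ : ℝ × ℝ → ℝ) (x : ℝ) : ℝ := φ (x, 0)

/-- Restriction to the upper boundary `y = h x`. -/
def onTop (h : ℝ → ℝ) (φ : ℝ × ℝ → ℝ) (x : ℝ) : ℝ := φ (x, h x)

/-- The space of stream functions: those `ψ ∈ H²` with `ψ = ψ_y = 0` on the lower boundary,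
`ψ` constant and `ψ_y = 0` on the upper boundary, in the sense of traces. -/
def Psi (h : ℝ → ℝ) : Set (H2 h) :=
  {ψ | HasTrace h onBottom ψ 0 ∧ HasTrace h (fun φ => onBottom (dy φ)) ψ 0 ∧
    (∃ (c : ℝ) (g : L2Boundary), ((g : ℝ → ℝ) =ᵐ[volume.restrict (Set.Icc 0 1)] fun _ => c) ∧
      HasTrace h (onTop h) ψ g) ∧
    HasTrace h (fun φ => onTop h (dy φ)) ψ 0}

/-- The weak derivative of `ψ ∈ H²` with label `i`, as a function on the domain. -/
def wD {h : ℝ → ℝ} (ψ : H2 h) (i : D2) : ℝ × ℝ → ℝ := (ψ : Jet h) i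

/-- The bilinear form
`a_ε(ψ, φ) = ∫_Ω ψ_yy φ_yy + 2 ε² ψ_xy φ_xy + ε⁴ ψ_xx φ_xx dA`. -/
def aForm {h : ℝ → ℝ} (ε : ℝ) (ψ φ : H2 h) : ℝ :=
  ∫ p, (wD ψ .yy p * wD φ .yy p + 2 * ε ^ 2 * (wD ψ .xy p * wD φ .xy p)
    + ε ^ 4 * (wD ψ .xx p * wD φ .xx p)) ∂(area h)

/-- `‖ψ‖₀² = ∫_Ω ψ² dA`. -/
def norm0Sq {h : ℝ → ℝ} (ψ : H2 h) : ℝ := ∫ p, wD ψ .o p ^ 2 ∂(area h)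

/-- `|ψ|²_{1,ε} = ∫_Ω ψ_y² + (ε ψ_x)² dA`. -/
def seminorm1Sq {h : ℝ → ℝ} (ε : ℝ) (ψ : H2 h) : ℝ :=
  ∫ p, (wD ψ .y p ^ 2 + (ε * wD ψ .x p) ^ 2) ∂(area h)

/-- `|ψ|²_{2,ε} = a_ε(ψ, ψ)`. -/
def seminorm2Sq {h : ℝ → ℝ} (ε : ℝ) (ψ : H2 h) : ℝ := aForm ε ψ ψ

/-- The weighted norm `‖ψ‖_{2,ε}`. -/
def weightedNorm2 {h : ℝ → ℝ} (ε : ℝ) (ψ : H2 h) : ℝ :=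
  Real.sqrt (norm0Sq ψ + seminorm1Sq ε ψ + seminorm2Sq ε ψ)

end Lubrication

end

/-!
Along a vertical line, a function `f` with `f = f_y = 0` at the bottom is an iterated integral of
`f_yy`, so Cauchy–Schwarz gives `‖f‖² ≤ H⁴ / 12 ‖f_yy‖²` and `‖f_y‖² ≤ H² / 2 ‖f_yy‖²` for `h ≤ H`;
likewise `‖f_x‖² ≤ H² / 2 ‖f_xy‖²`. Hence `‖ψ‖²_{2,ε} ≤ (1 + H² / 2 + H⁴ / 12) a_ε(ψ, ψ)`, and the
factor is `19 / 12` for `H = 1`.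

For `ψ ∈ H²` the two bottom conditions come with different approximating sequences. The trace
inequality `m ‖f(·, 0)‖² ≤ 2 ‖f‖² + H² ‖f_y‖²` (for `m ≤ h`) makes the bottom traces of `ψ_x` and
`ψ_y` independent of the sequence. The trace of `ψ_x` vanishes because it is the `L²` limit of
derivatives of periodic functions which tend to zero, and differentiation on the circle is closable.
-/

namespace Lubrication

open Filter Set
open scoped Topology

section SquareIntegrals

variable {α ι κ : Type*} [MeasurableSpace α] {μ : Measure α} {f g : α → ℝ}

theorem memLp_two_restrict_of_subset_isCompact [TopologicalSpace α] [T2Space α]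
    [OpensMeasurableSpace α] [IsFiniteMeasureOnCompacts μ] {s K : Set α} (hf : Continuous f)
    (hK : IsCompact K) (hs : s ⊆ K) : MemLp f 2 (μ.restrict s) :=
  (memLp_two_iff_integrable_sq hf.aestronglyMeasurable).2
    (((hf.pow 2).continuousOn.integrableOn_compact hK).mono_set hs)

theorem sq_norm_toLp_eq_integral_sq (hf : MemLp f 2 μ) :
    ‖hf.toLp f‖ ^ 2 = ∫ x, f x ^ 2 ∂μ := by
  rw [← real_inner_self_eq_norm_sq, L2.inner_def]
  refine integral_congr_ae ?_
  filter_upwards [hf.coeFn_toLp] with x hx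
  simp [hx, sq]

theorem sq_norm_sub_eq_integral_sq_sub {F G : Lp ℝ 2 μ} (hF : F =ᵐ[μ] f) (hG : G =ᵐ[μ] g) :
    ‖F - G‖ ^ 2 = ∫ x, (f x - g x) ^ 2 ∂μ := by
  rw [← Lp.toLp_coeFn (F - G) (Lp.memLp _), sq_norm_toLp_eq_integral_sq]
  refine integral_congr_ae ?_
  filter_upwards [Lp.coeFn_sub F G, hF, hG] with x hsub hFx hGx
  rw [hsub, Pi.sub_apply, hFx, hGx]

theorem sq_integral_mul_le (hf : MemLp f 2 μ) (hg : MemLp g 2 μ) :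
    (∫ x, f x * g x ∂μ) ^ 2 ≤ (∫ x, f x ^ 2 ∂μ) * ∫ x, g x ^ 2 ∂μ := by
  have hinner : inner ℝ (hf.toLp f) (hg.toLp g) = ∫ x, f x * g x ∂μ := by
    rw [L2.inner_def]
    refine integral_congr_ae ?_
    filter_upwards [hf.coeFn_toLp, hg.coeFn_toLp] with x hfx hgx
    simp [hfx, hgx, mul_comm]
  rw [← hinner, ← sq_norm_toLp_eq_integral_sq hf, ← sq_norm_toLp_eq_integral_sq hg, ← mul_pow,
    ← sq_abs]
  exact pow_le_pow_left₀ (abs_nonneg _) (abs_real_inner_le_norm _ _) 2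

theorem integral_sq_sub_le (hf : MemLp f 2 μ) (hg : MemLp g 2 μ) :
    ∫ x, (f x - g x) ^ 2 ∂μ ≤ 2 * ∫ x, f x ^ 2 ∂μ + 2 * ∫ x, g x ^ 2 ∂μ := by
  have hf2 := hf.integrable_sq.const_mul 2
  have hg2 := hg.integrable_sq.const_mul 2
  rw [← integral_const_mul, ← integral_const_mul, ← integral_add hf2 hg2]
  refine integral_mono (hf.sub hg).integrable_sq (hf2.add hg2) fun x => ?_
  linarith [sq_nonneg (f x + g x)]

variable {l : Filter ι} {F G R : ι → α → ℝ}

theorem tendsto_integral_sq_sub_zero (hF : ∀ i, MemLp (F i) 2 μ) (hG : ∀ i, MemLp (G i) 2 μ)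
    (hF0 : Tendsto (fun i => ∫ x, F i x ^ 2 ∂μ) l (𝓝 0))
    (hG0 : Tendsto (fun i => ∫ x, G i x ^ 2 ∂μ) l (𝓝 0)) :
    Tendsto (fun i => ∫ x, (F i x - G i x) ^ 2 ∂μ) l (𝓝 0) :=
  squeeze_zero (fun _ => integral_nonneg fun _ => sq_nonneg _)
    (fun i => integral_sq_sub_le (hF i) (hG i))
    (by simpa using (hF0.const_mul 2).add (hG0.const_mul 2))

theorem tendsto_integral_sq_add_zero (hF : ∀ i, MemLp (F i) 2 μ) (hG : ∀ i, MemLp (G i) 2 μ)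
    (hF0 : Tendsto (fun i => ∫ x, F i x ^ 2 ∂μ) l (𝓝 0))
    (hG0 : Tendsto (fun i => ∫ x, G i x ^ 2 ∂μ) l (𝓝 0)) :
    Tendsto (fun i => ∫ x, (F i x + G i x) ^ 2 ∂μ) l (𝓝 0) := by
  simpa using tendsto_integral_sq_sub_zero hF (fun i => (hG i).neg) hF0 (by simpa using hG0)

theorem tendsto_integral_sq_sub_prod {l' : Filter κ} {G : κ → α → ℝ}
    (hF : ∀ i, MemLp (F i) 2 μ) (hG : ∀ k, MemLp (G k) 2 μ) (hf : MemLp f 2 μ)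
    (hFf : Tendsto (fun i => ∫ x, (F i x - f x) ^ 2 ∂μ) l (𝓝 0))
    (hGf : Tendsto (fun k => ∫ x, (G k x - f x) ^ 2 ∂μ) l' (𝓝 0)) :
    Tendsto (fun q : ι × κ => ∫ x, (F q.1 x - G q.2 x) ^ 2 ∂μ) (l ×ˢ l') (𝓝 0) := by
  simpa only [Pi.sub_apply, sub_sub_sub_cancel_right] using
    tendsto_integral_sq_sub_zero (fun q : ι × κ => (hF q.1).sub hf) (fun q => (hG q.2).sub hf)
      (hFf.comp tendsto_fst) (hGf.comp tendsto_snd)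

theorem tendsto_integral_sq (hF : ∀ i, MemLp (F i) 2 μ) (hf : MemLp f 2 μ)
    (hFf : Tendsto (fun i => ∫ x, (F i x - f x) ^ 2 ∂μ) l (𝓝 0)) :
    Tendsto (fun i => ∫ x, F i x ^ 2 ∂μ) l (𝓝 (∫ x, f x ^ 2 ∂μ)) := by
  have hsqrt : Tendsto (fun i => √(∫ x, (F i x - f x) ^ 2 ∂μ)) l (𝓝 0) := by
    simpa using hFf.sqrt
  have hLp : Tendsto (fun i => (hF i).toLp (F i)) l (𝓝 (hf.toLp f)) := by
    rw [tendsto_iff_norm_sub_tendsto_zero]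
    refine hsqrt.congr fun i => ?_
    rw [← sq_norm_sub_eq_integral_sq_sub (hF i).coeFn_toLp hf.coeFn_toLp,
      Real.sqrt_sq (norm_nonneg _)]
  simpa only [sq_norm_toLp_eq_integral_sq] using hLp.norm.pow 2

theorem tendsto_integral_mul_zero (hF : ∀ i, MemLp (F i) 2 μ) (hg : MemLp g 2 μ)
    (hF0 : Tendsto (fun i => ∫ x, F i x ^ 2 ∂μ) l (𝓝 0)) :
    Tendsto (fun i => ∫ x, F i x * g x ∂μ) l (𝓝 0) :=
  squeeze_zero_norm (fun i => Real.abs_le_sqrt (sq_integral_mul_le (hF i) hg))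
    (by simpa using (hF0.mul_const (∫ x, g x ^ 2 ∂μ)).sqrt)

theorem tendsto_integral_sq_zero_of_cauchy_of_weak [l.NeBot] (hF : ∀ i, MemLp (F i) 2 μ)
    (hcauchy : Tendsto (fun q : ι × ι => ∫ x, (F q.1 x - F q.2 x) ^ 2 ∂μ) (l ×ˢ l) (𝓝 0))
    (hweak : ∀ j, Tendsto (fun i => ∫ x, F i x * F j x ∂μ) l (𝓝 0)) :
    Tendsto (fun i => ∫ x, F i x ^ 2 ∂μ) l (𝓝 0) := by
  have hle : ∀ i j, ∫ x, F j x ^ 2 ∂μ - 2 * ∫ x, F i x * F j x ∂μ ≤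
      ∫ x, (F j x - F i x) ^ 2 ∂μ := fun i j => by
    have hmul : Integrable (fun x => 2 * (F i x * F j x)) μ :=
      ((hF i).integrable_mul (hF j)).const_mul 2
    rw [← integral_const_mul, ← integral_sub (hF j).integrable_sq hmul]
    refine integral_mono ((hF j).integrable_sq.sub hmul)
      ((hF j).sub (hF i)).integrable_sq fun x => ?_
    linarith [sq_nonneg (F i x)]
  refine tendsto_order.2 ⟨fun a ha => Eventually.of_forall fun i =>
    ha.trans_le (integral_nonneg fun _ => sq_nonneg _), fun a ha => ?_⟩
  have hsmall : ∀ᶠ j in l, ∀ᶠ i in l, ∫ x, (F j x - F i x) ^ 2 ∂μ < a / 2 :=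
    (hcauchy.eventually_lt_const (half_pos ha)).curry
  filter_upwards [hsmall] with j hj
  have hlim : Tendsto (fun i => ∫ x, F j x ^ 2 ∂μ - 2 * ∫ x, F i x * F j x ∂μ) l
      (𝓝 (∫ x, F j x ^ 2 ∂μ)) := by
    simpa using ((hweak j).const_mul 2).const_sub (∫ x, F j x ^ 2 ∂μ)
  exact (le_of_tendsto hlim (hj.mono fun i hi => (hle i j).trans hi.le)).trans_lt (half_lt_self ha)

theorem integral_sq_le_of_tendsto [l.NeBot] {C : ℝ} (hF : ∀ i, MemLp (F i) 2 μ)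
    (hG : ∀ i, MemLp (G i) 2 μ) (hR : ∀ i, MemLp (R i) 2 μ) (hf : MemLp f 2 μ)
    (hg : MemLp g 2 μ) (hFf : Tendsto (fun i => ∫ x, (F i x - f x) ^ 2 ∂μ) l (𝓝 0))
    (hGg : Tendsto (fun i => ∫ x, (G i x - g x) ^ 2 ∂μ) l (𝓝 0))
    (hR0 : Tendsto (fun i => ∫ x, R i x ^ 2 ∂μ) l (𝓝 0))
    (hle : ∀ i, ∫ x, (F i x - R i x) ^ 2 ∂μ ≤ C * ∫ x, G i x ^ 2 ∂μ) :
    ∫ x, f x ^ 2 ∂μ ≤ C * ∫ x, g x ^ 2 ∂μ := by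
  have hFRf : Tendsto (fun i => ∫ x, (F i x - R i x - f x) ^ 2 ∂μ) l (𝓝 0) := by
    simpa only [Pi.sub_apply, sub_right_comm] using
      tendsto_integral_sq_sub_zero (fun i => (hF i).sub hf) hR hFf hR0
  exact le_of_tendsto_of_tendsto' (tendsto_integral_sq (fun i => (hF i).sub (hR i)) hf hFRf)
    ((tendsto_integral_sq hG hg hGg).const_mul C) hle

end SquareIntegrals

section Interval

variable {a b y : ℝ} {f f' f'' w : ℝ → ℝ}

theorem memLp_Icc (hw : Continuous w) : MemLp w 2 (volume.restrict (Icc a b)) :=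
  memLp_two_restrict_of_subset_isCompact hw isCompact_Icc subset_rfl

theorem integral_sub_pow (n : ℕ) (a y : ℝ) :
    ∫ t in a..y, (y - t) ^ n = (y - a) ^ (n + 1) / (n + 1) := by
  rw [intervalIntegral.integral_comp_sub_left (fun t => t ^ n) y, integral_pow]
  simp

theorem sq_integral_sub_pow_mul_le (n : ℕ) (hay : a ≤ y)
    (hw : MemLp w 2 (volume.restrict (Ioc a y))) :
    (∫ t in a..y, (y - t) ^ n * w t) ^ 2 ≤
      (y - a) ^ (2 * n + 1) / (2 * n + 1) * ∫ t in a..y, w t ^ 2 := by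
  have hpow : MemLp (fun t => (y - t) ^ n) 2 (volume.restrict (Ioc a y)) :=
    memLp_two_restrict_of_subset_isCompact (by fun_prop) isCompact_Icc Ioc_subset_Icc_self
  have hkernel : ∫ t in a..y, ((y - t) ^ n) ^ 2 = (y - a) ^ (2 * n + 1) / (2 * n + 1) := by
    simpa only [← pow_mul, mul_comm n, Nat.cast_mul, Nat.cast_ofNat] using
      integral_sub_pow (2 * n) a y
  rw [← hkernel]
  simpa only [intervalIntegral.integral_of_le hay] using sq_integral_mul_le hpow hw

theorem integral_sq_integral_sub_pow_mul_le (n : ℕ) (hab : a ≤ b)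
    (hw : MemLp w 2 (volume.restrict (Ioc a b))) :
    ∫ y in a..b, (∫ t in a..y, (y - t) ^ n * w t) ^ 2 ≤
      (b - a) ^ (2 * n + 2) / ((2 * n + 1) * (2 * n + 2)) * ∫ t in a..b, w t ^ 2 := by
  have hpoint : ∀ y ∈ Ioc a b, (∫ t in a..y, (y - t) ^ n * w t) ^ 2 ≤
      (y - a) ^ (2 * n + 1) / (2 * n + 1) * ∫ t in a..b, w t ^ 2 := fun y hy => by
    have hsub : Ioc a y ⊆ Ioc a b := Ioc_subset_Ioc_right hy.2
    have hya : 0 ≤ y - a := sub_nonneg.2 hy.1.le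
    refine (sq_integral_sub_pow_mul_le n hy.1.le
      (hw.mono_measure (Measure.restrict_mono hsub le_rfl))).trans ?_
    gcongr
    refine intervalIntegral.integral_mono_interval le_rfl hy.1.le hy.2
      (ae_of_all _ fun _ => sq_nonneg _) ?_
    exact (intervalIntegrable_iff_integrableOn_Ioc_of_le hab).2 hw.integrable_sq
  have hweight : ∫ y in a..b, (y - a) ^ (2 * n + 1) / (2 * n + 1) =
      (b - a) ^ (2 * n + 2) / ((2 * n + 1) * (2 * n + 2)) := by
    rw [intervalIntegral.integral_div,
      intervalIntegral.integral_comp_sub_right (fun t => t ^ (2 * n + 1)) a, integral_pow]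
    simp only [sub_self, ne_eq, Nat.add_eq_zero_iff, one_ne_zero, and_false, not_false_eq_true,
      zero_pow, sub_zero, Nat.cast_add, Nat.cast_mul, Nat.cast_ofNat, Nat.cast_one]
    field_simp
    ring
  rw [← hweight, ← intervalIntegral.integral_mul_const, intervalIntegral.integral_of_le hab,
    intervalIntegral.integral_of_le hab]
  refine integral_mono_of_nonneg (ae_of_all _ fun _ => sq_nonneg _) ?_
    (ae_restrict_of_forall_mem measurableSet_Ioc hpoint)
  exact (Continuous.integrableOn_Icc (by fun_prop)).mono_set Ioc_subset_Icc_self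

theorem sub_add_mul_deriv_eq_integral (hf : ∀ t ∈ uIcc a y, HasDerivAt f (f' t) t)
    (hf' : ∀ t ∈ uIcc a y, HasDerivAt f' (f'' t) t) (hf'' : IntervalIntegrable f'' volume a y) :
    f y - (f a + (y - a) * f' a) = ∫ t in a..y, (y - t) * f'' t := by
  have hprimitive : ∀ t ∈ uIcc a y,
      HasDerivAt (fun t => (y - t) * f' t + f t) ((y - t) * f'' t) t := fun t ht =>
    ((((hasDerivAt_id t).const_sub y).mul (hf' t ht)).add (hf t ht)).congr_deriv (by simp)
  rw [intervalIntegral.integral_eq_sub_of_hasDerivAt hprimitive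
    (hf''.continuousOn_mul (by fun_prop))]
  ring

theorem tendsto_integral_deriv_mul_zero {ι : Type*} {l : Filter ι} {u u' : ι → ℝ → ℝ}
    {v v' : ℝ → ℝ} (hab : a ≤ b) (hu : ∀ i t, HasDerivAt (u i) (u' i t) t)
    (hu' : ∀ i, Continuous (u' i)) (hv : ∀ t, HasDerivAt v (v' t) t) (hv' : Continuous v')
    (hu_ends : ∀ i, u i b = u i a) (hv_ends : v b = v a)
    (hu0 : Tendsto (fun i => ∫ t in Icc a b, u i t ^ 2) l (𝓝 0)) :
    Tendsto (fun i => ∫ t in Icc a b, u' i t * v t) l (𝓝 0) := by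
  have hparts : ∀ i, ∫ t in Icc a b, u' i t * v t = -∫ t in Icc a b, u i t * v' t := fun i => by
    simp only [integral_Icc_eq_integral_Ioc, ← intervalIntegral.integral_of_le hab]
    rw [intervalIntegral.integral_mul_deriv_eq_deriv_mul (fun t _ => hu i t) (fun t _ => hv t)
      ((hu' i).intervalIntegrable _ _) (hv'.intervalIntegrable _ _), hu_ends, hv_ends]
    ring
  have hu_cont : ∀ i, Continuous (u i) := fun i =>
    continuous_iff_continuousAt.2 fun t => (hu i t).continuousAt
  simp only [hparts]
  simpa using (tendsto_integral_mul_zero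
    (fun i => memLp_Icc (hu_cont i)) (memLp_Icc hv') hu0).neg

theorem tendsto_integral_sq_deriv_zero {ι : Type*} {l : Filter ι} [l.NeBot]
    {u u' u'' : ι → ℝ → ℝ} (hab : a ≤ b) (hu : ∀ i t, HasDerivAt (u i) (u' i t) t)
    (hu' : ∀ i t, HasDerivAt (u' i) (u'' i t) t) (hu'' : ∀ i, Continuous (u'' i))
    (hu_ends : ∀ i, u i b = u i a) (hu'_ends : ∀ i, u' i b = u' i a)
    (hu0 : Tendsto (fun i => ∫ t in Icc a b, u i t ^ 2) l (𝓝 0))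
    (hcauchy : Tendsto (fun q : ι × ι => ∫ t in Icc a b, (u' q.1 t - u' q.2 t) ^ 2)
      (l ×ˢ l) (𝓝 0)) :
    Tendsto (fun i => ∫ t in Icc a b, u' i t ^ 2) l (𝓝 0) := by
  have hu'_cont : ∀ i, Continuous (u' i) := fun i =>
    continuous_iff_continuousAt.2 fun t => (hu' i t).continuousAt
  exact tendsto_integral_sq_zero_of_cauchy_of_weak
    (fun i => memLp_Icc (hu'_cont i)) hcauchy fun j =>
      tendsto_integral_deriv_mul_zero hab hu hu'_cont (hu' j) (hu'' j) hu_ends (hu'_ends j) hu0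

end Interval

section PartialDerivatives

variable {φ : ℝ × ℝ → ℝ}

theorem hasDerivAt_fst_fderiv (hφ : Differentiable ℝ φ) (p : ℝ × ℝ) :
    HasDerivAt (fun t => φ (t, p.2)) (fderiv ℝ φ p (1, 0)) p.1 :=
  (hφ p).hasFDerivAt.comp_hasDerivAt p.1 ((hasDerivAt_id p.1).prodMk (hasDerivAt_const p.1 p.2))

theorem hasDerivAt_snd_fderiv (hφ : Differentiable ℝ φ) (p : ℝ × ℝ) :
    HasDerivAt (fun t => φ (p.1, t)) (fderiv ℝ φ p (0, 1)) p.2 :=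
  (hφ p).hasFDerivAt.comp_hasDerivAt p.2 ((hasDerivAt_const p.2 p.1).prodMk (hasDerivAt_id p.2))

theorem dx_eq_fderiv (hφ : Differentiable ℝ φ) : dx φ = fun p => fderiv ℝ φ p (1, 0) :=
  funext fun p => (hasDerivAt_fst_fderiv hφ p).deriv

theorem dy_eq_fderiv (hφ : Differentiable ℝ φ) : dy φ = fun p => fderiv ℝ φ p (0, 1) :=
  funext fun p => (hasDerivAt_snd_fderiv hφ p).deriv

theorem hasDerivAt_dx (hφ : Differentiable ℝ φ) (x y : ℝ) :
    HasDerivAt (fun t => φ (t, y)) (dx φ (x, y)) x :=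
  (hasDerivAt_fst_fderiv hφ (x, y)).differentiableAt.hasDerivAt

theorem hasDerivAt_dy (hφ : Differentiable ℝ φ) (x y : ℝ) :
    HasDerivAt (fun t => φ (x, t)) (dy φ (x, y)) y :=
  (hasDerivAt_snd_fderiv hφ (x, y)).differentiableAt.hasDerivAt

theorem contDiff_dx {n : ℕ} (hφ : ContDiff ℝ (n + 1) φ) : ContDiff ℝ n (dx φ) := by
  rw [dx_eq_fderiv (hφ.differentiable (by simp))]
  exact (hφ.fderiv_right le_rfl).clm_apply contDiff_const

theorem contDiff_dy {n : ℕ} (hφ : ContDiff ℝ (n + 1) φ) : ContDiff ℝ n (dy φ) := by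
  rw [dy_eq_fderiv (hφ.differentiable (by simp))]
  exact (hφ.fderiv_right le_rfl).clm_apply contDiff_const

theorem dy_dx_eq_dx_dy (hφ : ContDiff ℝ 2 φ) : dy (dx φ) = dx (dy φ) := by
  have hdiff : Differentiable ℝ φ := hφ.differentiable two_ne_zero
  have hdiff_dx : Differentiable ℝ (dx φ) := (contDiff_dx (n := 1) hφ).differentiable (by simp)
  have hdiff_dy : Differentiable ℝ (dy φ) := (contDiff_dy (n := 1) hφ).differentiable (by simp)
  have hdiff_fderiv : Differentiable ℝ (fderiv ℝ φ) :=
    (hφ.fderiv_right (m := 1) le_rfl).differentiable one_ne_zero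
  rw [dy_eq_fderiv hdiff_dx, dx_eq_fderiv hdiff_dy, dy_eq_fderiv hdiff, dx_eq_fderiv hdiff]
  funext p
  have hsecond : ∀ v w : ℝ × ℝ,
      fderiv ℝ (fun q => fderiv ℝ φ q v) p w = fderiv ℝ (fderiv ℝ φ) p w v := fun v w => by
    rw [((hdiff_fderiv p).hasFDerivAt.clm_apply (hasFDerivAt_const v p)).fderiv]
    simp
  have hsymm : IsSymmSndFDerivAt ℝ φ p := hφ.contDiffAt.isSymmSndFDerivAt (by simp)
  rw [hsecond, hsecond]
  exact hsymm _ _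

theorem dx_add_one (hφ : ∀ x y, φ (x + 1, y) = φ (x, y)) (x y : ℝ) :
    dx φ (x + 1, y) = dx φ (x, y) := by
  simpa only [hφ, dx] using (deriv_comp_add_const (fun t => φ (t, y)) 1 x).symm

theorem IsC2Periodic.differentiable (hφ : IsC2Periodic φ) : Differentiable ℝ φ :=
  hφ.1.differentiable two_ne_zero

theorem IsC2Periodic.contDiff_one_dx (hφ : IsC2Periodic φ) : ContDiff ℝ 1 (dx φ) :=
  contDiff_dx (n := 1) hφ.1

theorem IsC2Periodic.contDiff_one_dy (hφ : IsC2Periodic φ) : ContDiff ℝ 1 (dy φ) :=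
  contDiff_dy (n := 1) hφ.1

theorem IsC2Periodic.continuous_partialD (hφ : IsC2Periodic φ) : ∀ i, Continuous (partialD φ i)
  | .o => hφ.1.continuous
  | .x => hφ.contDiff_one_dx.continuous
  | .y => hφ.contDiff_one_dy.continuous
  | .xx => (contDiff_dx (n := 0) (by simpa using hφ.contDiff_one_dx)).continuous
  | .xy => (contDiff_dx (n := 0) (by simpa using hφ.contDiff_one_dy)).continuous
  | .yy => (contDiff_dy (n := 0) (by simpa using hφ.contDiff_one_dy)).continuous

/-- `f'` is the `y`-derivative of `f`, both being continuous on the plane. -/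
structure HasVerticalDeriv (f f' : ℝ × ℝ → ℝ) : Prop where
  continuous : Continuous f
  continuous_deriv : Continuous f'
  hasDerivAt : ∀ x y, HasDerivAt (fun t => f (x, t)) (f' (x, y)) y

theorem HasVerticalDeriv.sub {f f' g g' : ℝ × ℝ → ℝ} (hf : HasVerticalDeriv f f')
    (hg : HasVerticalDeriv g g') :
    HasVerticalDeriv (fun p => f p - g p) (fun p => f' p - g' p) where
  continuous := hf.continuous.sub hg.continuous
  continuous_deriv := hf.continuous_deriv.sub hg.continuous_deriv
  hasDerivAt x y := (hf.hasDerivAt x y).sub (hg.hasDerivAt x y)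

/-- The label `i'` denotes the `y`-derivative of the partial derivative with label `i`. -/
def IsVerticalDerivLabel (i i' : D2) : Prop :=
  ∀ φ, IsC2Periodic φ → HasVerticalDeriv (partialD φ i) (partialD φ i')

theorem isVerticalDerivLabel_o_y : IsVerticalDerivLabel .o .y := fun _ hφ =>
  ⟨hφ.continuous_partialD .o, hφ.continuous_partialD .y, hasDerivAt_dy hφ.differentiable⟩

theorem isVerticalDerivLabel_y_yy : IsVerticalDerivLabel .y .yy := fun _ hφ =>
  ⟨hφ.continuous_partialD .y, hφ.continuous_partialD .yy,
    hasDerivAt_dy (hφ.contDiff_one_dy.differentiable one_ne_zero)⟩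

theorem isVerticalDerivLabel_x_xy : IsVerticalDerivLabel .x .xy := fun φ hφ =>
  ⟨hφ.continuous_partialD .x, hφ.continuous_partialD .xy, by
    simpa only [partialD, ← dy_dx_eq_dx_dy hφ.1] using
      hasDerivAt_dy (hφ.contDiff_one_dx.differentiable one_ne_zero)⟩

end PartialDerivatives

section Domain

variable {h : ℝ → ℝ} {m H : ℝ} {F G f f' f'' : ℝ × ℝ → ℝ}

/-- The film thickness `h` is measurable and takes values in `[m, H]` over one period. -/
structure HasThicknessBounds (h : ℝ → ℝ) (m H : ℝ) : Prop where
  measurable : Measurable h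
  lower : ∀ x ∈ Icc (0 : ℝ) 1, m ≤ h x
  upper : ∀ x ∈ Icc (0 : ℝ) 1, h x ≤ H

theorem HasThicknessBounds.pow_le (hh : HasThicknessBounds h m H) (hm : 0 ≤ m) {x : ℝ}
    (hx : x ∈ Icc (0 : ℝ) 1) (n : ℕ) : h x ^ n ≤ H ^ n :=
  pow_le_pow_left₀ (hm.trans (hh.lower x hx)) (hh.upper x hx) n

theorem measurableSet_Omega (hmeas : Measurable h) : MeasurableSet (Omega h) := by
  have hregion : Omega h = regionBetween 0 h (Icc 0 1) := by
    ext p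
    simp [Omega, regionBetween, and_assoc]
  rw [hregion]
  exact measurableSet_regionBetween measurable_const hmeas measurableSet_Icc

theorem memLp_area (hH : ∀ x ∈ Icc (0 : ℝ) 1, h x ≤ H) (hF : Continuous F) :
    MemLp F 2 (area h) :=
  memLp_two_restrict_of_subset_isCompact hF (isCompact_Icc.prod (isCompact_Icc (b := H)))
    fun _ ⟨h0, h1, hy0, hy⟩ => ⟨⟨h0, h1⟩, hy0.le, hy.le.trans (hH _ ⟨h0, h1⟩)⟩

theorem integral_indicator_Omega_slice (hh : HasThicknessBounds h m H) (hm : 0 ≤ m)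
    (F : ℝ × ℝ → ℝ) (x : ℝ) :
    ∫ y, (Omega h).indicator F (x, y) =
      (Icc 0 1).indicator (fun x => ∫ y in (0 : ℝ)..h x, F (x, y)) x := by
  by_cases hx : x ∈ Icc (0 : ℝ) 1
  · have hslice : ∀ y, (Omega h).indicator F (x, y) =
        (Ioo 0 (h x)).indicator (fun y => F (x, y)) y := fun y =>
      indicator_eq_indicator (by simp [Omega, hx.1, hx.2]) rfl
    simp only [hslice]
    rw [indicator_of_mem hx, integral_indicator measurableSet_Ioo,
      intervalIntegral.integral_of_le (hm.trans (hh.lower x hx)), integral_Ioc_eq_integral_Ioo]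
  · have hslice : ∀ y, (Omega h).indicator F (x, y) = 0 := fun y =>
      indicator_of_notMem (fun hp => hx ⟨hp.1, hp.2.1⟩) F
    simp only [hslice, integral_zero, indicator_of_notMem hx]

theorem integrableOn_integral_slice (hh : HasThicknessBounds h m H) (hm : 0 ≤ m)
    (hF : Integrable F (area h)) :
    IntegrableOn (fun x => ∫ y in (0 : ℝ)..h x, F (x, y)) (Icc 0 1) := by
  have hind : Integrable ((Omega h).indicator F) (volume.prod volume) :=
    (integrable_indicator_iff (measurableSet_Omega hh.measurable)).2 hF
  simpa only [integral_indicator_Omega_slice hh hm, integrable_indicator_iff measurableSet_Icc]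
    using hind.integral_prod_left

theorem integral_area_eq_integral_slice (hh : HasThicknessBounds h m H) (hm : 0 ≤ m)
    (hF : Integrable F (area h)) :
    ∫ p, F p ∂area h = ∫ x in Icc (0 : ℝ) 1, ∫ y in (0 : ℝ)..h x, F (x, y) := by
  have hΩ := measurableSet_Omega hh.measurable
  rw [← integral_indicator hΩ, Measure.volume_eq_prod,
    integral_prod _ ((integrable_indicator_iff hΩ).2 hF)]
  simp only [integral_indicator_Omega_slice hh hm]
  exact integral_indicator measurableSet_Icc

theorem integral_area_le_of_slice_le (hh : HasThicknessBounds h m H) (hm : 0 ≤ m)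
    (hF : Integrable F (area h)) (hG : Integrable G (area h))
    (hle : ∀ x ∈ Icc (0 : ℝ) 1,
      ∫ y in (0 : ℝ)..h x, F (x, y) ≤ ∫ y in (0 : ℝ)..h x, G (x, y)) :
    ∫ p, F p ∂area h ≤ ∫ p, G p ∂area h := by
  rw [integral_area_eq_integral_slice hh hm hF, integral_area_eq_integral_slice hh hm hG]
  exact setIntegral_mono_on (integrableOn_integral_slice hh hm hF)
    (integrableOn_integral_slice hh hm hG) measurableSet_Icc hle

theorem integral_area_sq_integral_sub_pow_mul_le (n : ℕ) (hh : HasThicknessBounds h m H)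
    (hm : 0 ≤ m) (hF : Continuous F) (hG : Continuous G)
    (hFG : ∀ x y, F (x, y) = ∫ t in (0 : ℝ)..y, (y - t) ^ n * G (x, t)) :
    ∫ p, F p ^ 2 ∂area h ≤
      H ^ (2 * n + 2) / ((2 * n + 1) * (2 * n + 2)) * ∫ p, G p ^ 2 ∂area h := by
  rw [← integral_const_mul]
  refine integral_area_le_of_slice_le hh hm (memLp_area hh.upper hF).integrable_sq
    ((memLp_area hh.upper hG).integrable_sq.const_mul _) fun x hx => ?_
  have hx0 : 0 ≤ h x := hm.trans (hh.lower x hx)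
  have hint : 0 ≤ ∫ y in (0 : ℝ)..h x, G (x, y) ^ 2 :=
    intervalIntegral.integral_nonneg hx0 fun _ _ => sq_nonneg _
  have hpow := hh.pow_le hm hx (2 * n + 2)
  have hslice := integral_sq_integral_sub_pow_mul_le n hx0 (w := fun t => G (x, t))
    (memLp_two_restrict_of_subset_isCompact (by fun_prop) isCompact_Icc Ioc_subset_Icc_self)
  simp only [hFG, intervalIntegral.integral_const_mul]
  rw [sub_zero] at hslice
  exact hslice.trans (mul_le_mul_of_nonneg_right (by gcongr) hint)

theorem integral_sq_sub_bottom_le (hh : HasThicknessBounds h m H) (hm : 0 ≤ m)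
    (hf : HasVerticalDeriv f f') :
    ∫ p, (f p - f (p.1, 0)) ^ 2 ∂area h ≤ H ^ 2 / 2 * ∫ p, f' p ^ 2 ∂area h := by
  have hf_cont := hf.continuous
  have hf'_cont := hf.continuous_deriv
  simpa using integral_area_sq_integral_sub_pow_mul_le 0 hh hm
    (F := fun p => f p - f (p.1, 0)) (by fun_prop) hf'_cont fun x y => by
      simpa using (intervalIntegral.integral_eq_sub_of_hasDerivAt (fun t _ => hf.hasDerivAt x t)
        (Continuous.intervalIntegrable (by fun_prop) 0 y)).symm

theorem integral_sq_sub_bottom_taylor_le (hh : HasThicknessBounds h m H) (hm : 0 ≤ m)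
    (hf : HasVerticalDeriv f f') (hf' : HasVerticalDeriv f' f'') :
    ∫ p, (f p - (f (p.1, 0) + p.2 * f' (p.1, 0))) ^ 2 ∂area h ≤
      H ^ 4 / 12 * ∫ p, f'' p ^ 2 ∂area h := by
  have hf_cont := hf.continuous
  have hf'_cont := hf'.continuous
  have hf''_cont := hf'.continuous_deriv
  convert integral_area_sq_integral_sub_pow_mul_le 1 hh hm
    (F := fun p => f p - (f (p.1, 0) + p.2 * f' (p.1, 0))) (by fun_prop) hf''_cont
    fun x y => ?_ using 2
  · norm_num
  · simpa using sub_add_mul_deriv_eq_integral (fun t _ => hf.hasDerivAt x t)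
      (fun t _ => hf'.hasDerivAt x t) (Continuous.intervalIntegrable (by fun_prop) 0 y)

theorem integral_area_sq_pow_mul_le (k : ℕ) (hh : HasThicknessBounds h m H) (hm : 0 ≤ m)
    {u : ℝ → ℝ} (hu : Continuous u) :
    ∫ p, (p.2 ^ k * u p.1) ^ 2 ∂area h ≤
      H ^ (2 * k + 1) / (2 * k + 1) * ∫ x in Icc (0 : ℝ) 1, u x ^ 2 := by
  have hint : Integrable (fun p : ℝ × ℝ => (p.2 ^ k * u p.1) ^ 2) (area h) :=
    (memLp_area hh.upper (by fun_prop)).integrable_sq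
  rw [integral_area_eq_integral_slice hh hm hint, ← integral_const_mul]
  refine setIntegral_mono_on (integrableOn_integral_slice hh hm hint)
    ((memLp_Icc hu).integrable_sq.const_mul _) measurableSet_Icc fun x hx => ?_
  have hslice : ∫ y in (0 : ℝ)..h x, (y ^ k * u x) ^ 2 =
      h x ^ (2 * k + 1) / (2 * k + 1) * u x ^ 2 := by
    simp [mul_pow, ← pow_mul, mul_comm k]
  rw [hslice]
  have hpow := hh.pow_le hm hx (2 * k + 1)
  gcongr

theorem mul_integral_sq_le_integral_area_sq (hh : HasThicknessBounds h m H) (hm : 0 ≤ m)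
    {u : ℝ → ℝ} (hu : Continuous u) :
    m * ∫ x in Icc (0 : ℝ) 1, u x ^ 2 ≤ ∫ p, u p.1 ^ 2 ∂area h := by
  have hint : Integrable (fun p : ℝ × ℝ => u p.1 ^ 2) (area h) :=
    (memLp_area hh.upper (by fun_prop)).integrable_sq
  rw [integral_area_eq_integral_slice hh hm hint, ← integral_const_mul]
  refine setIntegral_mono_on ((memLp_Icc hu).integrable_sq.const_mul m)
    (integrableOn_integral_slice hh hm hint) measurableSet_Icc fun x hx => ?_
  simp only [intervalIntegral.integral_const, smul_eq_mul, sub_zero]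
  exact mul_le_mul_of_nonneg_right (hh.lower x hx) (sq_nonneg _)

theorem mul_integral_sq_bottom_le (hh : HasThicknessBounds h m H) (hm : 0 ≤ m)
    (hf : HasVerticalDeriv f f') :
    m * ∫ x in Icc (0 : ℝ) 1, f (x, 0) ^ 2 ≤
      2 * ∫ p, f p ^ 2 ∂area h + H ^ 2 * ∫ p, f' p ^ 2 ∂area h := by
  have hf_cont := hf.continuous
  have hbottom : ∫ p, f (p.1, 0) ^ 2 ∂area h ≤
      2 * ∫ p, f p ^ 2 ∂area h + 2 * ∫ p, (f p - f (p.1, 0)) ^ 2 ∂area h := by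
    simpa using integral_sq_sub_le (memLp_area hh.upper hf_cont)
      (memLp_area (F := fun p => f p - f (p.1, 0)) hh.upper (by fun_prop))
  linarith [integral_sq_sub_bottom_le hh hm hf,
    mul_integral_sq_le_integral_area_sq hh hm (u := fun x => f (x, 0)) (by fun_prop)]

end Domain

section Approximation

variable {h : ℝ → ℝ} {m H : ℝ} {i i' : D2} {ψ : H2 h} {φ χ : ℕ → ℝ × ℝ → ℝ}

/-- The periodic `C²` functions `φ n` converge to `ψ` in `H²` of the domain. -/
structure ConvergesInH2 (φ : ℕ → ℝ × ℝ → ℝ) (ψ : H2 h) : Prop where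
  isC2Periodic : ∀ n, IsC2Periodic (φ n)
  tendsto : ∀ i, Tendsto (fun n => ∫ p, (partialD (φ n) i p - wD ψ i p) ^ 2 ∂area h) atTop (𝓝 0)

instance : Finite D2 :=
  Finite.of_surjective (![.o, .x, .y, .xx, .xy, .yy] : Fin 6 → D2) (by
    rintro (_ | _ | _ | _ | _ | _)
    exacts [⟨0, rfl⟩, ⟨1, rfl⟩, ⟨2, rfl⟩, ⟨3, rfl⟩, ⟨4, rfl⟩, ⟨5, rfl⟩])

theorem HasTrace.exists_convergesInH2 {τ : (ℝ × ℝ → ℝ) → ℝ → ℝ} {g : L2Boundary} {u : ℝ → ℝ}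
    (hτ : HasTrace h τ ψ g) (hg : g =ᵐ[volume.restrict (Icc 0 1)] u) :
    ∃ φ, ConvergesInH2 φ ψ ∧
      Tendsto (fun n => ∫ x in Icc (0 : ℝ) 1, (τ (φ n) x - u x) ^ 2) atTop (𝓝 0) := by
  obtain ⟨q, hq, hlim⟩ := mem_closure_iff_seq_limit.1 hτ
  choose φ hφ hjet htrace using hq
  obtain ⟨hlim_jet, hlim_trace⟩ := (Prod.tendsto_iff _ _).1 hlim
  refine ⟨φ, ⟨hφ, fun i => ?_⟩, ?_⟩
  · have hsq := (tendsto_iff_norm_sub_tendsto_zero.1 (tendsto_pi_nhds.1 hlim_jet i)).pow 2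
    rw [zero_pow two_ne_zero] at hsq
    exact hsq.congr fun n => sq_norm_sub_eq_integral_sq_sub (hjet n i) EventuallyEq.rfl
  · have hsq := (tendsto_iff_norm_sub_tendsto_zero.1 hlim_trace).pow 2
    rw [zero_pow two_ne_zero] at hsq
    exact hsq.congr fun n => sq_norm_sub_eq_integral_sq_sub (htrace n) hg

theorem HasTrace.exists_convergesInH2_of_zero {τ : (ℝ × ℝ → ℝ) → ℝ → ℝ} (hτ : HasTrace h τ ψ 0) :
    ∃ φ, ConvergesInH2 φ ψ ∧
      Tendsto (fun n => ∫ x in Icc (0 : ℝ) 1, τ (φ n) x ^ 2) atTop (𝓝 0) := by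
  simpa using hτ.exists_convergesInH2 (Lp.coeFn_zero ℝ 2 _)

theorem memLp_wD (ψ : H2 h) (i : D2) : MemLp (wD ψ i) 2 (area h) := Lp.memLp _

theorem IsC2Periodic.memLp_bottom {φ : ℝ × ℝ → ℝ} (hφ : IsC2Periodic φ) (i : D2) :
    MemLp (fun x => partialD φ i (x, 0)) 2 (volume.restrict (Icc (0 : ℝ) 1)) :=
  memLp_Icc ((hφ.continuous_partialD i).comp (Continuous.prodMk_left 0))

theorem IsC2Periodic.memLp_partialD {φ : ℝ × ℝ → ℝ} (hφ : IsC2Periodic φ)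
    (hh : HasThicknessBounds h m H) (i : D2) : MemLp (partialD φ i) 2 (area h) :=
  memLp_area hh.upper (hφ.continuous_partialD i)

theorem tendsto_integral_sq_bottom_sub (hh : HasThicknessBounds h m H) (hm : 0 < m)
    (hi : IsVerticalDerivLabel i i') (hφ : ConvergesInH2 φ ψ) (hχ : ConvergesInH2 χ ψ) :
    Tendsto (fun q : ℕ × ℕ =>
      ∫ x in Icc (0 : ℝ) 1, (partialD (φ q.1) i (x, 0) - partialD (χ q.2) i (x, 0)) ^ 2)
      (atTop ×ˢ atTop) (𝓝 0) := by
  have hinterior : ∀ j, Tendsto (fun q : ℕ × ℕ =>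
      ∫ p, (partialD (φ q.1) j p - partialD (χ q.2) j p) ^ 2 ∂area h)
      (atTop ×ˢ atTop) (𝓝 0) := fun j =>
    tendsto_integral_sq_sub_prod (F := fun n => partialD (φ n) j)
      (G := fun n => partialD (χ n) j) (fun n => (hφ.isC2Periodic n).memLp_partialD hh j)
      (fun n => (hχ.isC2Periodic n).memLp_partialD hh j) (memLp_wD ψ j) (hφ.tendsto j)
      (hχ.tendsto j)
  refine squeeze_zero (fun _ => integral_nonneg fun _ => sq_nonneg _)
    (fun q => (le_div_iff₀' hm).2 (mul_integral_sq_bottom_le hh hm.le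
      ((hi _ (hφ.isC2Periodic q.1)).sub (hi _ (hχ.isC2Periodic q.2))))) ?_
  simpa using (((hinterior i).const_mul 2).add ((hinterior i').const_mul (H ^ 2))).div_const m

theorem ConvergesInH2.tendsto_integral_sq_bottom_zero (hφ : ConvergesInH2 φ ψ)
    (hh : HasThicknessBounds h m H) (hm : 0 < m) (hi : IsVerticalDerivLabel i i')
    (hχ : ConvergesInH2 χ ψ)
    (hχ0 : Tendsto (fun n => ∫ x in Icc (0 : ℝ) 1, partialD (χ n) i (x, 0) ^ 2) atTop (𝓝 0)) :
    Tendsto (fun n => ∫ x in Icc (0 : ℝ) 1, partialD (φ n) i (x, 0) ^ 2) atTop (𝓝 0) := by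
  have hdiff : Tendsto (fun n => ∫ x in Icc (0 : ℝ) 1,
      (partialD (φ n) i (x, 0) - partialD (χ n) i (x, 0)) ^ 2) atTop (𝓝 0) := by
    have hcomp := (tendsto_integral_sq_bottom_sub hh hm hi hφ hχ).comp tendsto_diag
    simpa only [Function.comp_def, Function.diag] using hcomp
  simpa only [sub_add_cancel] using tendsto_integral_sq_add_zero
    (F := fun n x => partialD (φ n) i (x, 0) - partialD (χ n) i (x, 0))
    (G := fun n x => partialD (χ n) i (x, 0))
    (fun n => ((hφ.isC2Periodic n).memLp_bottom i).sub ((hχ.isC2Periodic n).memLp_bottom i))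
    (fun n => (hχ.isC2Periodic n).memLp_bottom i) hdiff hχ0

theorem ConvergesInH2.tendsto_integral_sq_bottom_dx_zero (hφ : ConvergesInH2 φ ψ)
    (hh : HasThicknessBounds h m H) (hm : 0 < m)
    (hφ0 : Tendsto (fun n => ∫ x in Icc (0 : ℝ) 1, φ n (x, 0) ^ 2) atTop (𝓝 0)) :
    Tendsto (fun n => ∫ x in Icc (0 : ℝ) 1, dx (φ n) (x, 0) ^ 2) atTop (𝓝 0) := by
  have hderiv : ∀ n x, HasDerivAt (fun t => φ n (t, 0)) (dx (φ n) (x, 0)) x := fun n x =>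
    hasDerivAt_dx (hφ.isC2Periodic n).differentiable x 0
  have hderiv' : ∀ n x, HasDerivAt (fun t => dx (φ n) (t, 0)) (dx (dx (φ n)) (x, 0)) x :=
    fun n x => hasDerivAt_dx ((hφ.isC2Periodic n).contDiff_one_dx.differentiable one_ne_zero) x 0
  have hcont : ∀ n, Continuous fun x => dx (dx (φ n)) (x, 0) := fun n =>
    ((hφ.isC2Periodic n).continuous_partialD .xx).comp (Continuous.prodMk_left 0)
  have hcauchy := tendsto_integral_sq_bottom_sub hh hm isVerticalDerivLabel_x_xy hφ hφ
  simp only [partialD] at hcauchy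
  refine tendsto_integral_sq_deriv_zero zero_le_one hderiv hderiv' hcont ?_ ?_ hφ0 hcauchy
  · exact fun n => by simpa using (hφ.isC2Periodic n).2 0 0
  · exact fun n => by simpa using dx_add_one (hφ.isC2Periodic n).2 0 0

theorem ConvergesInH2.tendsto_integral_area_sq_pow_mul_bottom_zero (hφ : ConvergesInH2 φ ψ)
    (hh : HasThicknessBounds h m H) (hm : 0 ≤ m) (k : ℕ)
    (hφ0 : Tendsto (fun n => ∫ x in Icc (0 : ℝ) 1, partialD (φ n) i (x, 0) ^ 2) atTop (𝓝 0)) :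
    Tendsto (fun n => ∫ p, (p.2 ^ k * partialD (φ n) i (p.1, 0)) ^ 2 ∂area h) atTop (𝓝 0) :=
  squeeze_zero (fun _ => integral_nonneg fun _ => sq_nonneg _)
    (fun n => integral_area_sq_pow_mul_le k hh hm (u := fun x => partialD (φ n) i (x, 0))
      (((hφ.isC2Periodic n).continuous_partialD i).comp (Continuous.prodMk_left 0)))
    (by simpa using hφ0.const_mul (H ^ (2 * k + 1) / (2 * k + 1)))

theorem ConvergesInH2.integral_sq_wD_le (hφ : ConvergesInH2 φ ψ)
    (hh : HasThicknessBounds h m H) (hm : 0 ≤ m) (hi : IsVerticalDerivLabel i i')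
    (hφ0 : Tendsto (fun n => ∫ x in Icc (0 : ℝ) 1, partialD (φ n) i (x, 0) ^ 2) atTop (𝓝 0)) :
    ∫ p, wD ψ i p ^ 2 ∂area h ≤ H ^ 2 / 2 * ∫ p, wD ψ i' p ^ 2 ∂area h := by
  refine integral_sq_le_of_tendsto (fun n => (hφ.isC2Periodic n).memLp_partialD hh i)
    (fun n => (hφ.isC2Periodic n).memLp_partialD hh i') (fun n => memLp_area hh.upper ?_)
    (memLp_wD ψ i) (memLp_wD ψ i') (hφ.tendsto i) (hφ.tendsto i')
    (by simpa using hφ.tendsto_integral_area_sq_pow_mul_bottom_zero hh hm 0 hφ0)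
    fun n => integral_sq_sub_bottom_le hh hm (hi _ (hφ.isC2Periodic n))
  exact ((hφ.isC2Periodic n).continuous_partialD i).comp (by fun_prop)

theorem ConvergesInH2.norm0Sq_le (hφ : ConvergesInH2 φ ψ)
    (hh : HasThicknessBounds h m H) (hm : 0 ≤ m)
    (hφ0 : Tendsto (fun n => ∫ x in Icc (0 : ℝ) 1, φ n (x, 0) ^ 2) atTop (𝓝 0))
    (hφ0' : Tendsto (fun n => ∫ x in Icc (0 : ℝ) 1, dy (φ n) (x, 0) ^ 2) atTop (𝓝 0)) :
    norm0Sq ψ ≤ H ^ 4 / 12 * ∫ p, wD ψ .yy p ^ 2 ∂area h := by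
  have hbottom : ∀ i n, Continuous fun p : ℝ × ℝ => partialD (φ n) i (p.1, 0) := fun i n =>
    ((hφ.isC2Periodic n).continuous_partialD i).comp (by fun_prop)
  have hvalue : ∀ n, MemLp (fun p : ℝ × ℝ => φ n (p.1, 0)) 2 (area h) := fun n =>
    memLp_area hh.upper (hbottom .o n)
  have hslope : ∀ n, MemLp (fun p : ℝ × ℝ => p.2 * dy (φ n) (p.1, 0)) 2 (area h) := fun n =>
    memLp_area hh.upper (continuous_snd.mul (hbottom .y n))
  refine integral_sq_le_of_tendsto (fun n => (hφ.isC2Periodic n).memLp_partialD hh .o)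
    (fun n => (hφ.isC2Periodic n).memLp_partialD hh .yy) (fun n => (hvalue n).add (hslope n))
    (memLp_wD ψ .o) (memLp_wD ψ .yy) (hφ.tendsto .o) (hφ.tendsto .yy) ?_
    fun n => integral_sq_sub_bottom_taylor_le hh hm
      (isVerticalDerivLabel_o_y _ (hφ.isC2Periodic n))
      (isVerticalDerivLabel_y_yy _ (hφ.isC2Periodic n))
  exact tendsto_integral_sq_add_zero hvalue hslope
    (by simpa [partialD] using
      hφ.tendsto_integral_area_sq_pow_mul_bottom_zero (i := .o) hh hm 0 hφ0)
    (by simpa [partialD] using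
      hφ.tendsto_integral_area_sq_pow_mul_bottom_zero (i := .y) hh hm 1 hφ0')

end Approximation

section Coercivity

variable {h : ℝ → ℝ} {m H : ℝ}

theorem aForm_self (ε : ℝ) (ψ : H2 h) :
    aForm ε ψ ψ = ∫ p, wD ψ .yy p ^ 2 ∂area h + 2 * ε ^ 2 * ∫ p, wD ψ .xy p ^ 2 ∂area h
      + ε ^ 4 * ∫ p, wD ψ .xx p ^ 2 ∂area h := by
  have hyy := (memLp_wD ψ .yy).integrable_sq
  have hxy := (memLp_wD ψ .xy).integrable_sq.const_mul (2 * ε ^ 2)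
  have hxx := (memLp_wD ψ .xx).integrable_sq.const_mul (ε ^ 4)
  simp only [aForm, ← sq]
  rw [integral_add (hyy.fun_add hxy) hxx, integral_add hyy hxy, integral_const_mul,
    integral_const_mul]

theorem seminorm1Sq_eq (ε : ℝ) (ψ : H2 h) :
    seminorm1Sq ε ψ = ∫ p, wD ψ .y p ^ 2 ∂area h + ε ^ 2 * ∫ p, wD ψ .x p ^ 2 ∂area h := by
  simp only [seminorm1Sq, mul_pow]
  rw [integral_add (memLp_wD ψ .y).integrable_sq
    ((memLp_wD ψ .x).integrable_sq.const_mul (ε ^ 2)), integral_const_mul]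

theorem integral_sq_wD_nonneg (ψ : H2 h) (i : D2) : 0 ≤ ∫ p, wD ψ i p ^ 2 ∂area h :=
  integral_nonneg fun _ => sq_nonneg _

theorem integral_sq_yy_add_integral_sq_xy_le_aForm (ε : ℝ) (ψ : H2 h) :
    ∫ p, wD ψ .yy p ^ 2 ∂area h + ε ^ 2 * ∫ p, wD ψ .xy p ^ 2 ∂area h ≤ aForm ε ψ ψ := by
  have hxy : 0 ≤ ε ^ 2 * ∫ p, wD ψ .xy p ^ 2 ∂area h :=
    mul_nonneg (sq_nonneg ε) (integral_sq_wD_nonneg ψ .xy)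
  have hxx : 0 ≤ ε ^ 4 * ∫ p, wD ψ .xx p ^ 2 ∂area h :=
    mul_nonneg (by positivity) (integral_sq_wD_nonneg ψ .xx)
  rw [aForm_self]
  linarith

theorem integral_sq_yy_le_aForm (ε : ℝ) (ψ : H2 h) :
    ∫ p, wD ψ .yy p ^ 2 ∂area h ≤ aForm ε ψ ψ :=
  (le_add_of_nonneg_right (mul_nonneg (sq_nonneg ε) (integral_sq_wD_nonneg ψ .xy))).trans
    (integral_sq_yy_add_integral_sq_xy_le_aForm ε ψ)

theorem sq_weightedNorm2 (ε : ℝ) (ψ : H2 h) :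
    weightedNorm2 ε ψ ^ 2 = norm0Sq ψ + seminorm1Sq ε ψ + aForm ε ψ ψ := by
  have hnorm0 : 0 ≤ norm0Sq ψ := integral_sq_wD_nonneg ψ .o
  have hseminorm1 : 0 ≤ seminorm1Sq ε ψ := integral_nonneg fun _ => by positivity
  have hseminorm2 : 0 ≤ seminorm2Sq ε ψ :=
    (integral_sq_wD_nonneg ψ .yy).trans (integral_sq_yy_le_aForm ε ψ)
  exact Real.sq_sqrt (by positivity)

theorem sq_weightedNorm2_le (hh : HasThicknessBounds h m H) (hm : 0 < m) (ε : ℝ) {ψ : H2 h}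
    (hψ : HasTrace h onBottom ψ 0) (hψy : HasTrace h (fun φ => onBottom (dy φ)) ψ 0) :
    weightedNorm2 ε ψ ^ 2 ≤ (1 + H ^ 2 / 2 + H ^ 4 / 12) * aForm ε ψ ψ := by
  obtain ⟨φ, hφ, hφ0⟩ := hψ.exists_convergesInH2_of_zero
  obtain ⟨χ, hχ, hχy0⟩ := hψy.exists_convergesInH2_of_zero
  have hφy0 := hφ.tendsto_integral_sq_bottom_zero hh hm isVerticalDerivLabel_y_yy hχ hχy0
  have hφx0 := hφ.tendsto_integral_sq_bottom_dx_zero hh hm hφ0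
  have hnorm0 : norm0Sq ψ ≤ H ^ 4 / 12 * aForm ε ψ ψ :=
    (hφ.norm0Sq_le hh hm.le hφ0 hφy0).trans
      (mul_le_mul_of_nonneg_left (integral_sq_yy_le_aForm ε ψ) (by positivity))
  have hseminorm1 : seminorm1Sq ε ψ ≤ H ^ 2 / 2 * aForm ε ψ ψ := by
    have hy := hφ.integral_sq_wD_le hh hm.le isVerticalDerivLabel_y_yy hφy0
    have hx := hφ.integral_sq_wD_le hh hm.le isVerticalDerivLabel_x_xy hφx0
    calc seminorm1Sq ε ψ
        = ∫ p, wD ψ .y p ^ 2 ∂area h + ε ^ 2 * ∫ p, wD ψ .x p ^ 2 ∂area h :=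
          seminorm1Sq_eq ε ψ
      _ ≤ H ^ 2 / 2 * ∫ p, wD ψ .yy p ^ 2 ∂area h +
          ε ^ 2 * (H ^ 2 / 2 * ∫ p, wD ψ .xy p ^ 2 ∂area h) := by gcongr
      _ = H ^ 2 / 2 *
          (∫ p, wD ψ .yy p ^ 2 ∂area h + ε ^ 2 * ∫ p, wD ψ .xy p ^ 2 ∂area h) := by ring
      _ ≤ H ^ 2 / 2 * aForm ε ψ ψ := by
          gcongr
          exact integral_sq_yy_add_integral_sq_xy_le_aForm ε ψ
  linarith [sq_weightedNorm2 ε ψ]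

theorem exists_hasThicknessBounds (hcont : Continuous h) (hpos : ∀ x ∈ Icc (0 : ℝ) 1, 0 < h x) :
    ∃ m H, 0 < m ∧ HasThicknessBounds h m H := by
  have hne : (Icc (0 : ℝ) 1).Nonempty := nonempty_Icc.2 zero_le_one
  obtain ⟨a, ha, hmin⟩ := isCompact_Icc.exists_isMinOn hne hcont.continuousOn
  obtain ⟨b, -, hmax⟩ := isCompact_Icc.exists_isMaxOn hne hcont.continuousOn
  exact ⟨h a, h b, hpos a ha, hcont.measurable, hmin, hmax⟩

end Coercivity

end Lubrication

theorem mainTheorem5_general {h : ℝ → ℝ} {m H : ℝ} (hm : 0 < m)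
    (hh : Lubrication.HasThicknessBounds h m H) :
    (∃ α : ℝ, 0 < α ∧ ∀ (ε : ℝ) (ψ : Lubrication.H2 h),
      Lubrication.HasTrace h Lubrication.onBottom ψ 0 →
      Lubrication.HasTrace h (fun φ => Lubrication.onBottom (Lubrication.dy φ)) ψ 0 →
      α * Lubrication.weightedNorm2 ε ψ ^ 2 ≤ Lubrication.aForm ε ψ ψ) ∧
    ((∀ x ∈ Set.Icc (0 : ℝ) 1, h x ≤ 1) → ∀ (ε : ℝ) (ψ : Lubrication.H2 h),
      Lubrication.HasTrace h Lubrication.onBottom ψ 0 →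
      Lubrication.HasTrace h (fun φ => Lubrication.onBottom (Lubrication.dy φ)) ψ 0 →
      (12 / 19 : ℝ) * Lubrication.weightedNorm2 ε ψ ^ 2 ≤ Lubrication.aForm ε ψ ψ) := by
  refine ⟨⟨(1 + H ^ 2 / 2 + H ^ 4 / 12)⁻¹, by positivity, fun ε ψ hψ hψy => ?_⟩,
    fun h_le_one ε ψ hψ hψy => ?_⟩
  · exact (inv_mul_le_iff₀ (by positivity)).2 (Lubrication.sq_weightedNorm2_le hh hm ε hψ hψy)
  · have hle := Lubrication.sq_weightedNorm2_le { hh with upper := h_le_one } hm ε hψ hψy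
    linarith

theorem mainTheorem5 (h : ℝ → ℝ) (hreg : Lubrication.IsC11Periodic h) (hpos : ∀ x, 0 < h x) :
    (∃ α : ℝ, 0 < α ∧ ∀ ε : ℝ, 0 < ε → ∀ ψ ∈ Lubrication.Psi h,
      α * Lubrication.weightedNorm2 ε ψ ^ 2 ≤ Lubrication.aForm ε ψ ψ) ∧
    ((∀ x, h x ≤ 1) → ∀ ε : ℝ, 0 < ε → ∀ ψ ∈ Lubrication.Psi h,
      (12 / 19 : ℝ) * Lubrication.weightedNorm2 ε ψ ^ 2 ≤ Lubrication.aForm ε ψ ψ) := by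
  obtain ⟨m, H, hm, hh⟩ :=
    Lubrication.exists_hasThicknessBounds hreg.2.1.continuous fun x _ => hpos x
  obtain ⟨⟨α, hα, hcoercive⟩, hcoercive_of_le_one⟩ := mainTheorem5_general hm hh
  exact ⟨⟨α, hα, fun ε _ ψ hψ => hcoercive ε ψ hψ.1 hψ.2.1⟩, fun h_le_one ε _ ψ hψ =>
    hcoercive_of_le_one (fun x _ => h_le_one x) ε ψ hψ.1 hψ.2.1⟩
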